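/- Let $m\ge 1$ and $n_*>m$ be integers and let $\rho,\eta>0$. Let $(N(t))_{t\ge 0}$ be the number of customers in the Erlang A ($M/M/m+M$) model with arrival rate $\rho$, $m$ servers of rate $1$ and abandonment rate $\eta$; that is, $N$ is the birth-death process on $\{0,1,2,\dots\}$ with birth rate $\rho$ in every state and with death rate $n$ in the states $n\le m$ and $m+(n-m)\eta$ in the states $n\ge m$ (it is described by its jump chain and its independent exponential holding times). Let $\tau(n_*)=\min\{t\ge 0: N(t)=n_*\}$ and, for $0\le n\le n_*$, $\widehat Q_n(\theta)=E[e^{-\theta\tau(n_*)}\mid N(0)=n]$, $\theta\ge 0$. Then there are real numbers $q_0,\dots,q_{n_*}$, depending only on $m,n_*,\rho,\eta$, such that for every such process and every $0\le n\le n_*$ with $P[N(0)=n]>0$, conditionally on $N(0)=n$ the minimum $\tau(n_*)$ exists almost surely and $$q_n=E[\tau(n_*)\mid N(0)=n]=-\widehat Q_n'(0)$$ (right derivative at $0$), and these numbers are given by $$q_n=q_m+\sum_{j=n}^{m-1}j!\,\rho^{-j}\sum_{\ell=0}^{j}\frac{\rho^{\ell-1}}{\ell!},\qquad 0\le n\le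 m,$$ $$q_m=\frac1\rho\sum_{J=m}^{n_*-1}\left[\left(\frac{\rho}{\eta}\right)^{m-J}\frac{\Gamma\left(J-m+1+\frac m\eta\right)}{\Gamma\left(1+\frac m\eta\right)}\sum_{\ell=0}^{m}\frac{m!}{\ell!}\rho^{\ell-m}+\sum_{\ell=m+1}^{J}\left(\frac{\rho}{\eta}\right)^{\ell-J}\frac{\Gamma\left(J-m+1+\frac m\eta\right)}{\Gamma\left(\ell-m+1+\frac m\eta\right)}\right],$$ $$q_n=\frac1\rho\sum_{J=n}^{n_*-1}\sum_{\ell=m+1}^{J}\left(\frac{\rho}{\eta}\right)^{\ell-J}\frac{\Gamma\left(J-m+1+\frac m\eta\right)}{\Gamma\left(\ell-m+1+\frac m\eta\right)}+\frac1\rho\left(\frac{\rho}{\eta}\right)^{m}\frac{1}{\Gamma\left(1+\frac m\eta\right)}\left[\sum_{\ell=0}^{m}\frac{m!}{\ell!}\rho^{\ell-m}\right]\left[\sum_{J=n}^{n_*-1}\left(\frac{\eta}{\rho}\right)^{J}\Gamma\left(J-m+1+\frac m\eta\right)\right],\qquad m\le n<n_*,$$ and $q_{n_*}=0$. -/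

import Mathlib

open MeasureTheory ProbabilityTheory
open scoped NNReal ENNReal

/-- One-step probabilities `i → j` of the jump chain of a birth-death process on `ℕ` with birth
rates `b` and death rates `d` (used for rates with `b i + d i > 0` and `d 0 = 0`). -/
noncomputable def jumpProb (b d : ℕ → ℝ) (i j : ℕ) : ℝ :=
  if j = i + 1 then b i / (b i + d i)
  else if j + 1 = i then d i / (b i + d i)
  else 0

/-- `N` is a birth-death process on `ℕ` with birth rates `b` and death rates `d` (no absorbing
state: `b i + d i > 0` for all `i`), with an arbitrary initial law: `N` visits successively the
states `Y 0, Y 1, …` and stays there for the times `S 0, S 1, …`, where `Y` is a Markov chain with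
transition probabilities `jumpProb b d` and, given `Y`, the holding times `S k` are independent
and exponential with rates `b (Y k) + d (Y k)`. -/
structure IsBirthDeathProcess {Ω : Type*} [MeasurableSpace Ω] (b d : ℕ → ℝ) (P : Measure Ω)
    (N : ℝ≥0 → Ω → ℕ) : Prop where
  measurable : ∀ t, Measurable (N t)
  exists_jump_holding : ∃ (Y : ℕ → Ω → ℕ) (S : ℕ → Ω → ℝ),
    (∀ k, Measurable (Y k)) ∧ (∀ k, Measurable (S k)) ∧
    (∀ (k : ℕ) (i : ℕ → ℕ) (s : ℕ → ℝ), (∀ r, 0 ≤ s r) →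
      P.real {ω | ∀ r ≤ k, Y r ω = i r ∧ s r < S r ω} =
        P.real {ω | Y 0 ω = i 0} *
          (∏ r ∈ Finset.range k, jumpProb b d (i r) (i (r + 1))) *
          ∏ r ∈ Finset.range (k + 1), Real.exp (-((b (i r) + d (i r)) * s r))) ∧
    ∀ᵐ ω ∂P, ∀ (k : ℕ) (t : ℝ≥0),
      ∑ r ∈ Finset.range k, S r ω ≤ (t : ℝ) →
      (t : ℝ) < ∑ r ∈ Finset.range (k + 1), S r ω →
      N t ω = Y k ω

/-- Departure rate in state `n` with `m` servers of rate `1` and abandonment rate `η`: it is `n`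
for `n ≤ m` and `m + (n - m) η` for `n ≥ m`. -/
noncomputable def erlangADeathRate (m : ℕ) (η : ℝ) (n : ℕ) : ℝ :=
  if n ≤ m then (n : ℝ) else (m : ℝ) + ((n : ℝ) - (m : ℝ)) * η

/-- The number in system of the Erlang A model (`M/M/m+M`): arrival rate `ρ`, `m` servers of
rate `1`, abandonment rate `η`. -/
def IsErlangA {Ω : Type*} [MeasurableSpace Ω] (m : ℕ) (ρ η : ℝ) (P : Measure Ω)
    (N : ℝ≥0 → Ω → ℕ) : Prop :=
  IsBirthDeathProcess (fun _ => ρ) (erlangADeathRate m η) P N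

/-- First passage time to the state `k` (equal to `∞` if `k` is never visited). -/
noncomputable def firstPassageTime {Ω : Type*} (N : ℝ≥0 → Ω → ℕ) (k : ℕ) (ω : Ω) : ℝ≥0∞ :=
  sInf ((fun t : ℝ≥0 => (t : ℝ≥0∞)) '' {t : ℝ≥0 | N t ω = k})

/-!
Let `q n` be the sum of the mean passage times `J → J + 1` over `n ≤ J < K`. First-step analysis
shows that `q i = 1 / (b i + d i) + ∑ j, p i j * q j` for `i < K`, with `p` the jump probabilities,
and `q` vanishes from `K` on. Integrating this along the jump chain killed at `K`, the mean of the
holding times of the first `n` steps spent below `K`, plus the mean of `q (Y n)` on the event that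
the chain is still below `K`, equals the mean of `q (Y 0)`. Hence the mean holding times are
summable. As the rates are bounded on `{0, …, K - 1}`, the remainder is at most a constant times
the `n`-th of them and tends to `0`; so does the probability of still being below `K`. Thus `K` is
reached almost surely, in mean time `q n` from `n ≤ K`.

The mean passage time `J → J + 1` unrolls to a sum of products of the ratios `d r / b r`, which for
the Erlang A rates are quotients of factorials up to `m` and of Gamma values above `m`.
-/

section Measure

variable {Ω : Type*} [MeasurableSpace Ω] {μ : Measure Ω}

theorem setLIntegral_preimage_congr_of_fiber {ι : Type*} [Countable ι] [MeasurableSpace ι]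
    [MeasurableSingletonClass ι] {H : Ω → ι} (hH : Measurable H) {f g : Ω → ℝ≥0∞}
    (hfg : ∀ ω₀, ∫⁻ ω in H ⁻¹' {H ω₀}, f ω ∂μ = ∫⁻ ω in H ⁻¹' {H ω₀}, g ω ∂μ) (C : Set ι) :
    ∫⁻ ω in H ⁻¹' C, f ω ∂μ = ∫⁻ ω in H ⁻¹' C, g ω ∂μ := by
  have hfiber : ∀ x, ∫⁻ ω in H ⁻¹' {x}, f ω ∂μ = ∫⁻ ω in H ⁻¹' {x}, g ω ∂μ := by
    intro x
    by_cases hx : x ∈ Set.range H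
    · obtain ⟨ω₀, rfl⟩ := hx
      exact hfg ω₀
    · simp [Set.preimage_singleton_eq_empty.2 hx]
  have hmeas : ∀ x ∈ C, MeasurableSet (H ⁻¹' {x}) := fun x _ => hH (measurableSet_singleton x)
  have hdisj : C.PairwiseDisjoint fun x => H ⁻¹' {x} := Set.pairwiseDisjoint_fiber H C
  rw [← Set.biUnion_preimage_singleton, lintegral_biUnion C.to_countable hmeas hdisj,
    lintegral_biUnion C.to_countable hmeas hdisj]
  exact tsum_congr fun x => hfiber x

theorem ae_of_forall_fiber {ι : Type*} [Countable ι] {H : Ω → ι} {p : Ω → Prop}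
    (hp : ∀ ω₀, ∀ᵐ ω ∂μ, H ω = H ω₀ → p ω) : ∀ᵐ ω ∂μ, p ω := by
  have hfiber : ∀ x, ∀ᵐ ω ∂μ, H ω = x → p ω := by
    intro x
    by_cases hx : x ∈ Set.range H
    · obtain ⟨ω₀, rfl⟩ := hx
      exact hp ω₀
    · exact Filter.Eventually.of_forall fun ω hω => absurd ⟨ω, hω⟩ hx
  filter_upwards [ae_all_iff.2 hfiber] with ω hω using hω _ rfl

theorem tsum_measure_inter_preimage_singleton {ι : Type*} [Countable ι] [MeasurableSpace ι]
    [MeasurableSingletonClass ι] {H : Ω → ι} (hH : Measurable H) (A : Set Ω) :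
    ∑' i, μ (A ∩ H ⁻¹' {i}) = μ A := by
  have hA := lintegral_countable' (μ := (μ.restrict A).map H) fun _ => 1
  simp_rw [lintegral_one, one_mul, Measure.map_apply hH (measurableSet_singleton _),
    Measure.restrict_apply (hH (measurableSet_singleton _)), Measure.map_apply hH .univ,
    Set.preimage_univ, Measure.restrict_apply_univ, Set.inter_comm _ A] at hA
  exact hA.symm

theorem lintegral_ofReal_of_exp_tail [IsFiniteMeasure μ] {X : Ω → ℝ} (hX : AEMeasurable X μ)
    (hX0 : 0 ≤ᵐ[μ] X) {c : ℝ} (hc : 0 < c) {a : ℝ}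
    (htail : ∀ s, 0 ≤ s → μ.real {ω | s < X ω} = a * Real.exp (-(c * s))) :
    ∫⁻ ω, ENNReal.ofReal (X ω) ∂μ = ENNReal.ofReal (a * (1 / c)) := by
  have ha : μ.real {ω | 0 < X ω} = a := by simpa using htail 0 le_rfl
  have ha_nonneg : 0 ≤ a := ha ▸ measureReal_nonneg
  calc ∫⁻ ω, ENNReal.ofReal (X ω) ∂μ = ∫⁻ s in Set.Ioi 0, μ {ω | s < X ω} :=
        lintegral_eq_lintegral_meas_lt μ hX0 hX
    _ = ∫⁻ s in Set.Ioi 0, ENNReal.ofReal (a * Real.exp (-c * s)) := by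
        refine setLIntegral_congr_fun measurableSet_Ioi fun s (hs : 0 < s) => ?_
        rw [neg_mul, ← htail s hs.le, ofReal_measureReal]
    _ = ENNReal.ofReal (∫ s in Set.Ioi 0, a * Real.exp (-c * s)) :=
        (ofReal_integral_eq_lintegral_ofReal
          ((integrableOn_exp_mul_Ioi (neg_lt_zero.2 hc) 0).const_mul a)
          (Filter.Eventually.of_forall fun s => by positivity)).symm
    _ = ENNReal.ofReal (a * (1 / c)) := by
        rw [integral_const_mul, integral_exp_mul_Ioi (neg_lt_zero.2 hc), mul_zero, Real.exp_zero,
          neg_div_neg_eq]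

theorem hasDerivWithinAt_integral_of_dominated_slope {E : Type*} [NormedAddCommGroup E]
    [NormedSpace ℝ E] {F : ℝ → Ω → E} {F' : Ω → E} {bound : Ω → ℝ} {s : Set ℝ} {x : ℝ}
    (hx : x ∈ s) (hF : ∀ θ ∈ s, Integrable (F θ) μ) (hbound : Integrable bound μ)
    (hslope : ∀ θ ∈ s \ {x}, ∀ᵐ ω ∂μ, ‖slope (F · ω) x θ‖ ≤ bound ω)
    (hderiv : ∀ᵐ ω ∂μ, HasDerivWithinAt (F · ω) (F' ω) s x) :
    HasDerivWithinAt (fun θ => ∫ ω, F θ ω ∂μ) (∫ ω, F' ω ∂μ) s x := by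
  have hslope_integral : ∀ θ ∈ s \ {x},
      ∫ ω, slope (F · ω) x θ ∂μ = slope (fun θ => ∫ ω, F θ ω ∂μ) x θ := by
    intro θ hθ
    simp only [slope, vsub_eq_sub]
    rw [integral_smul, integral_sub (hF θ hθ.1) (hF x hx)]
  rw [hasDerivWithinAt_iff_tendsto_slope]
  refine Filter.Tendsto.congr' (Filter.eventually_of_mem self_mem_nhdsWithin hslope_integral) ?_
  refine tendsto_integral_filter_of_dominated_convergence bound ?_
    (Filter.eventually_of_mem self_mem_nhdsWithin hslope) hbound ?_
  · filter_upwards [self_mem_nhdsWithin] with θ hθ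
    exact (((hF θ hθ.1).sub (hF x hx)).smul (θ - x)⁻¹).aestronglyMeasurable
  · filter_upwards [hderiv] with ω hω using hasDerivWithinAt_iff_tendsto_slope.1 hω

theorem abs_exp_neg_sub_one_le {x : ℝ} (hx : 0 ≤ x) : |Real.exp (-x) - 1| ≤ x := by
  rw [abs_sub_comm, abs_of_nonneg (sub_nonneg.2 (Real.exp_le_one_iff.2 (neg_nonpos.2 hx)))]
  linarith [Real.one_sub_le_exp_neg x]

theorem hasDerivWithinAt_laplace_zero [IsFiniteMeasure μ] {X : Ω → ℝ} (hX : Integrable X μ)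
    (hX0 : 0 ≤ᵐ[μ] X) :
    HasDerivWithinAt (fun θ : ℝ => ∫ ω, Real.exp (-(θ * X ω)) ∂μ) (-∫ ω, X ω ∂μ)
      (Set.Ici 0) 0 := by
  rw [← integral_neg]
  refine hasDerivWithinAt_integral_of_dominated_slope Set.self_mem_Ici (fun θ hθ => ?_) hX
    (fun θ hθ => ?_) (Filter.Eventually.of_forall fun ω => ?_)
  · refine Integrable.of_bound (Real.continuous_exp.comp_aestronglyMeasurable
      (hX.aestronglyMeasurable.const_mul θ).neg) 1 ?_
    filter_upwards [hX0] with ω hω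
    rw [Real.norm_eq_abs, Real.abs_exp, Real.exp_le_one_iff, neg_nonpos]
    exact mul_nonneg hθ hω
  · have hθ_pos : 0 < θ := lt_of_le_of_ne hθ.1 (Ne.symm hθ.2)
    filter_upwards [hX0] with ω hω
    rw [slope_def_field, zero_mul, neg_zero, Real.exp_zero, sub_zero, norm_div,
      Real.norm_of_nonneg hθ_pos.le, div_le_iff₀ hθ_pos, mul_comm (X ω)]
    exact abs_exp_neg_sub_one_le (mul_nonneg hθ_pos.le hω)
  · simpa using ((hasDerivAt_id (0 : ℝ)).mul_const (X ω)).neg.exp.hasDerivWithinAt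

theorem hasDerivWithinAt_laplace_toReal_zero [IsFiniteMeasure μ] {τ : Ω → ℝ≥0∞}
    (hτ : AEMeasurable τ μ) (hfin : ∫⁻ ω, τ ω ∂μ ≠ ∞) :
    HasDerivWithinAt (fun θ : ℝ => ∫ ω, Real.exp (-(θ * (τ ω).toReal)) ∂μ)
      (-(∫⁻ ω, τ ω ∂μ).toReal) (Set.Ici 0) 0 := by
  rw [← integral_toReal hτ (ae_lt_top' hτ hfin)]
  exact hasDerivWithinAt_laplace_zero (integrable_toReal_of_lintegral_ne_top hτ hfin)
    (Filter.Eventually.of_forall fun ω => ENNReal.toReal_nonneg)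

end Measure

section JumpProb

variable {b d : ℕ → ℝ}

theorem jumpProb_succ (b d : ℕ → ℝ) (i : ℕ) : jumpProb b d i (i + 1) = b i / (b i + d i) :=
  if_pos rfl

theorem jumpProb_pred (hd₀ : d 0 = 0) (i : ℕ) :
    jumpProb b d i (i - 1) = d i / (b i + d i) := by
  rcases i with _ | i
  · simp [jumpProb, hd₀]
  · rw [Nat.add_sub_cancel, jumpProb, if_neg (by omega), if_pos rfl]

theorem eq_add_one_or_of_jumpProb_ne_zero {i j : ℕ} (hij : jumpProb b d i j ≠ 0) :
    j = i + 1 ∨ j + 1 = i := by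
  contrapose! hij
  rw [jumpProb, if_neg hij.1, if_neg hij.2]

theorem tsum_jumpProb_mul (hd₀ : d 0 = 0) (i : ℕ) (g : ℕ → ℝ≥0∞) :
    ∑' j, ENNReal.ofReal (jumpProb b d i j) * g j =
      ENNReal.ofReal (b i / (b i + d i)) * g (i + 1) +
        ENNReal.ofReal (d i / (b i + d i)) * g (i - 1) := by
  rw [tsum_eq_sum (s := {i + 1, i - 1}), Finset.sum_pair (by omega), jumpProb_succ,
    jumpProb_pred hd₀]
  intro j hj
  have hij : jumpProb b d i j = 0 := by
    by_contra hne
    have := eq_add_one_or_of_jumpProb_ne_zero hne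
    simp only [Finset.mem_insert, Finset.mem_singleton] at hj
    omega
  rw [hij, ENNReal.ofReal_zero, zero_mul]

theorem tsum_jumpProb (hb : ∀ i, 0 < b i) (hd : ∀ i, 0 ≤ d i) (hd₀ : d 0 = 0) (i : ℕ) :
    ∑' j, ENNReal.ofReal (jumpProb b d i j) = 1 := by
  have hbi := hb i
  have hdi := hd i
  have hsum := tsum_jumpProb_mul hd₀ (b := b) i fun _ => 1
  simp only [mul_one] at hsum
  rw [hsum, ← ENNReal.ofReal_add (by positivity) (by positivity), ← add_div,
    div_self (by positivity), ENNReal.ofReal_one]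

end JumpProb

/-- The mean time that the birth-death process with birth rates `b` and death rates `d` takes to
go from `k` to `k + 1`. The recursion is the first-step equation in the state `k + 1` solved for
the passage from there. -/
noncomputable def meanUpTime (b d : ℕ → ℝ) : ℕ → ℝ
  | 0 => 1 / b 0
  | k + 1 => (1 + d (k + 1) * meanUpTime b d k) / b (k + 1)

/-- The mean first passage time from `n` to `K` of the birth-death process with birth rates `b`
and death rates `d`, with the value `0` for `n ≥ K`. -/
noncomputable def meanPassageTime (b d : ℕ → ℝ) (K n : ℕ) : ℝ :=
  ∑ J ∈ Finset.Ico n K, meanUpTime b d J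

section MeanPassageTime

variable {b d : ℕ → ℝ}

theorem meanUpTime_pos (hb : ∀ i, 0 < b i) (hd : ∀ i, 0 ≤ d i) (k : ℕ) : 0 < meanUpTime b d k := by
  induction k with
  | zero => exact one_div_pos.2 (hb 0)
  | succ k ih =>
    exact div_pos (add_pos_of_pos_of_nonneg one_pos (mul_nonneg (hd _) ih.le)) (hb _)

theorem meanPassageTime_nonneg (hb : ∀ i, 0 < b i) (hd : ∀ i, 0 ≤ d i) (K n : ℕ) :
    0 ≤ meanPassageTime b d K n :=
  Finset.sum_nonneg fun k _ => (meanUpTime_pos hb hd k).le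

theorem meanPassageTime_antitone (hb : ∀ i, 0 < b i) (hd : ∀ i, 0 ≤ d i) (K : ℕ) :
    Antitone (meanPassageTime b d K) := fun _ _ hij =>
  Finset.sum_le_sum_of_subset_of_nonneg (Finset.Ico_subset_Ico_left hij) fun k _ _ =>
    (meanUpTime_pos hb hd k).le

theorem meanPassageTime_of_le {K n : ℕ} (hKn : K ≤ n) : meanPassageTime b d K n = 0 := by
  rw [meanPassageTime, Finset.Ico_eq_empty_of_le hKn, Finset.sum_empty]

theorem meanPassageTime_eq_add {K n : ℕ} (hn : n < K) :
    meanPassageTime b d K n = meanUpTime b d n + meanPassageTime b d K (n + 1) :=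
  Finset.sum_eq_sum_Ico_succ_bot hn _

theorem meanPassageTime_eq_add_sum {K m n : ℕ} (hnm : n ≤ m) (hmK : m ≤ K) :
    meanPassageTime b d K n =
      meanPassageTime b d K m + ∑ j ∈ Finset.Ico n m, meanUpTime b d j := by
  rw [add_comm]
  exact (Finset.sum_Ico_consecutive _ hnm hmK).symm

theorem meanUpTime_eq_sum (b d : ℕ → ℝ) (J : ℕ) :
    meanUpTime b d J =
      ∑ l ∈ Finset.range (J + 1), 1 / b l * ∏ r ∈ Finset.Ioc l J, d r / b r := by
  induction J with
  | zero => simp [meanUpTime]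
  | succ J ih =>
    have hprod : ∀ l ∈ Finset.range (J + 1), 1 / b l * ∏ r ∈ Finset.Ioc l (J + 1), d r / b r =
        d (J + 1) / b (J + 1) * (1 / b l * ∏ r ∈ Finset.Ioc l J, d r / b r) := by
      intro l hl
      rw [Finset.prod_Ioc_succ_top (Finset.mem_range_succ_iff.1 hl)]
      ring
    rw [meanUpTime, ih, Finset.sum_range_succ _ (J + 1), Finset.sum_congr rfl hprod,
      ← Finset.mul_sum, Finset.Ioc_self, Finset.prod_empty]
    ring

theorem meanPassageTime_poisson (hb : ∀ i, 0 < b i) (hd : ∀ i, 0 ≤ d i) (hd₀ : d 0 = 0)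
    {K i : ℕ} (hi : i < K) :
    b i / (b i + d i) * meanPassageTime b d K (i + 1) +
        d i / (b i + d i) * meanPassageTime b d K (i - 1) + 1 / (b i + d i) =
      meanPassageTime b d K i := by
  have hbi := hb i
  have hdi := hd i
  rw [meanPassageTime_eq_add hi]
  rcases i with _ | i
  · rw [hd₀, meanUpTime]
    field_simp
    ring
  · rw [Nat.add_sub_cancel, meanPassageTime_eq_add (Nat.lt_of_succ_lt hi),
      meanPassageTime_eq_add hi, meanUpTime]
    field_simp
    ring

theorem tsum_jumpProb_mul_meanPassageTime (hb : ∀ i, 0 < b i) (hd : ∀ i, 0 ≤ d i)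
    (hd₀ : d 0 = 0) {K i : ℕ} (hi : i < K) :
    ∑' j, ENNReal.ofReal (jumpProb b d i j) * ENNReal.ofReal (meanPassageTime b d K j) +
        ENNReal.ofReal (1 / (b i + d i)) =
      ENNReal.ofReal (meanPassageTime b d K i) := by
  have hbi := hb i
  have hdi := hd i
  have hq := meanPassageTime_nonneg hb hd K
  have hsucc := mul_nonneg (by positivity : 0 ≤ b i / (b i + d i)) (hq (i + 1))
  have hpred := mul_nonneg (by positivity : 0 ≤ d i / (b i + d i)) (hq (i - 1))
  rw [tsum_jumpProb_mul hd₀, ← ENNReal.ofReal_mul (by positivity),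
    ← ENNReal.ofReal_mul (by positivity), ← ENNReal.ofReal_add hsucc hpred,
    ← ENNReal.ofReal_add (add_nonneg hsucc hpred) (by positivity),
    meanPassageTime_poisson hb hd hd₀ hi]

theorem setLIntegral_lt_inter_meanPassageTime {Ω : Type*} [MeasurableSpace Ω] {P : Measure Ω}
    {Z : Ω → ℕ} (hZ : Measurable Z) (b d : ℕ → ℝ) (K : ℕ) (A : Set Ω) :
    ∫⁻ ω in {ω | Z ω < K} ∩ A, ENNReal.ofReal (meanPassageTime b d K (Z ω)) ∂P =
      ∫⁻ ω in A, ENNReal.ofReal (meanPassageTime b d K (Z ω)) ∂P := by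
  have hvanish : {ω | Z ω < K}.indicator (fun ω => ENNReal.ofReal (meanPassageTime b d K (Z ω))) =
      fun ω => ENNReal.ofReal (meanPassageTime b d K (Z ω)) := by
    refine Set.indicator_eq_self.2 fun ω hω => ?_
    contrapose! hω
    simp [meanPassageTime_of_le (not_lt.1 hω)]
  rw [← setLIntegral_indicator (measurableSet_lt hZ measurable_const), hvanish]

end MeanPassageTime

/-- The path `Y 0, …, Y k` of the chain `Y`. -/
def chainPath {Ω : Type*} (Y : ℕ → Ω → ℕ) (k : ℕ) (ω : Ω) : Set.Iic k → ℕ :=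
  fun r => Y r ω

/-- The event that the chain `Y` stays below the level `K` up to time `k`. -/
def stayBelow {Ω : Type*} (Y : ℕ → Ω → ℕ) (K k : ℕ) : Set Ω :=
  {ω | ∀ r ≤ k, Y r ω < K}

/-- The total holding time before the chain `Y` with holding times `S` first reaches a level
`≥ K`. -/
noncomputable def timeBelow {Ω : Type*} (Y : ℕ → Ω → ℕ) (S : ℕ → Ω → ℝ) (K : ℕ) (ω : Ω) : ℝ≥0∞ :=
  ∑' k, (stayBelow Y K k).indicator (fun ω => ENNReal.ofReal (S k ω)) ω

/-- The joint law of the jump chain `Y` and the holding times `S` of a birth-death process, as it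
appears in `IsBirthDeathProcess`. -/
structure JumpHoldingLaw {Ω : Type*} [MeasurableSpace Ω] (b d : ℕ → ℝ) (P : Measure Ω)
    (Y : ℕ → Ω → ℕ) (S : ℕ → Ω → ℝ) : Prop where
  measurable_chain : ∀ k, Measurable (Y k)
  measurable_holding : ∀ k, Measurable (S k)
  measureReal_path_holding : ∀ (k : ℕ) (i : ℕ → ℕ) (s : ℕ → ℝ), (∀ r, 0 ≤ s r) →
    P.real {ω | ∀ r ≤ k, Y r ω = i r ∧ s r < S r ω} =
      P.real {ω | Y 0 ω = i 0} *
        (∏ r ∈ Finset.range k, jumpProb b d (i r) (i (r + 1))) *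
        ∏ r ∈ Finset.range (k + 1), Real.exp (-((b (i r) + d (i r)) * s r))

section ChainPath

variable {Ω : Type*} {Y : ℕ → Ω → ℕ}

theorem preimage_chainPath_singleton (k : ℕ) (ω₀ : Ω) :
    chainPath Y k ⁻¹' {chainPath Y k ω₀} = {ω | ∀ r ≤ k, Y r ω = Y r ω₀} := by
  ext ω
  simp [chainPath, funext_iff]

theorem stayBelow_eq_preimage (K k : ℕ) :
    stayBelow Y K k = chainPath Y k ⁻¹' {x | ∀ r, x r < K} := by
  ext ω
  simp [stayBelow, chainPath]

theorem stayBelow_succ (K k : ℕ) :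
    stayBelow Y K (k + 1) = {ω | Y (k + 1) ω < K} ∩ stayBelow Y K k := by
  ext ω
  simp [stayBelow, Nat.le_add_one_iff, or_imp, forall_and, and_comm]

end ChainPath

namespace JumpHoldingLaw

variable {Ω : Type*} [MeasurableSpace Ω] {b d : ℕ → ℝ} {P : Measure Ω}
  {Y : ℕ → Ω → ℕ} {S : ℕ → Ω → ℝ}

theorem measurable_chainPath (h : JumpHoldingLaw b d P Y S) (k : ℕ) :
    Measurable (chainPath Y k) :=
  measurable_pi_lambda _ fun r => h.measurable_chain r

theorem measurableSet_path (h : JumpHoldingLaw b d P Y S) (k : ℕ) (i : ℕ → ℕ) :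
    MeasurableSet {ω | ∀ r ≤ k, Y r ω = i r} := by
  have := h.measurable_chain
  measurability

theorem measurableSet_stayBelow (h : JumpHoldingLaw b d P Y S) (K k : ℕ) :
    MeasurableSet (stayBelow Y K k) := by
  rw [stayBelow_eq_preimage]
  exact h.measurable_chainPath k (Set.to_countable _).measurableSet

theorem measurable_timeBelow (h : JumpHoldingLaw b d P Y S) (K : ℕ) :
    Measurable (timeBelow Y S K) :=
  Measurable.tsum fun k =>
    (h.measurable_holding k).ennreal_ofReal.indicator (h.measurableSet_stayBelow K k)

theorem setLIntegral_stayBelow_zero (h : JumpHoldingLaw b d P Y S) (K : ℕ) :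
    ∫⁻ ω in stayBelow Y K 0, ENNReal.ofReal (meanPassageTime b d K (Y 0 ω)) ∂P =
      ∫⁻ ω, ENNReal.ofReal (meanPassageTime b d K (Y 0 ω)) ∂P := by
  have hset : stayBelow Y K 0 = {ω | Y 0 ω < K} ∩ Set.univ := by simp [stayBelow]
  rw [hset, setLIntegral_lt_inter_meanPassageTime (h.measurable_chain 0), setLIntegral_univ]

theorem measureReal_posPath (h : JumpHoldingLaw b d P Y S) (k : ℕ) (i : ℕ → ℕ) :
    P.real {ω | ∀ r ≤ k, Y r ω = i r ∧ 0 < S r ω} =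
      P.real {ω | Y 0 ω = i 0} * ∏ r ∈ Finset.range k, jumpProb b d (i r) (i (r + 1)) := by
  simpa using h.measureReal_path_holding k i (fun _ => 0) fun _ => le_rfl

theorem measureReal_posPath_inter_succ (h : JumpHoldingLaw b d P Y S) (k : ℕ) (i : ℕ → ℕ) (j : ℕ) :
    P.real ({ω | ∀ r ≤ k, Y r ω = i r ∧ 0 < S r ω} ∩ {ω | Y (k + 1) ω = j ∧ 0 < S (k + 1) ω}) =
      P.real {ω | ∀ r ≤ k, Y r ω = i r ∧ 0 < S r ω} * jumpProb b d (i k) j := by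
  set i' := Function.update i (k + 1) j
  have hi'_le : ∀ r ≤ k, i' r = i r := fun r hr => Function.update_of_ne (by omega) _ _
  have hi'_succ : i' (k + 1) = j := Function.update_self ..
  have hset : {ω | ∀ r ≤ k, Y r ω = i r ∧ 0 < S r ω} ∩ {ω | Y (k + 1) ω = j ∧ 0 < S (k + 1) ω} =
      {ω | ∀ r ≤ k + 1, Y r ω = i' r ∧ 0 < S r ω} := by
    ext ω
    simp only [Nat.le_add_one_iff, or_imp, forall_and, forall_eq, hi'_succ, Set.mem_inter_iff,
      Set.mem_ofPred_eq]
    grind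
  have hprod : ∏ r ∈ Finset.range k, jumpProb b d (i' r) (i' (r + 1)) =
      ∏ r ∈ Finset.range k, jumpProb b d (i r) (i (r + 1)) :=
    Finset.prod_congr rfl fun r hr => by
      have hrk := Finset.mem_range.1 hr
      rw [hi'_le r hrk.le, hi'_le (r + 1) hrk]
  rw [hset, h.measureReal_posPath, h.measureReal_posPath, Finset.prod_range_succ, hprod,
    hi'_le 0 k.zero_le, hi'_le k le_rfl, hi'_succ, mul_assoc]

variable [IsFiniteMeasure P]

-- The law only describes paths with positive holding times; these already carry the whole mass,
-- because the jump probabilities out of each state add up to `1`.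
theorem ae_holding_zero_pos (h : JumpHoldingLaw b d P Y S) : ∀ᵐ ω ∂P, 0 < S 0 ω := by
  refine ae_of_forall_fiber (H := Y 0) fun ω₀ => ?_
  have hle : {ω | Y 0 ω = Y 0 ω₀ ∧ 0 < S 0 ω} =ᵐ[P] {ω | Y 0 ω = Y 0 ω₀} := by
    refine ae_eq_of_subset_of_measure_ge (fun ω hω => hω.1) (le_of_eq ?_) ?_ (measure_ne_top _ _)
    · rw [← measureReal_eq_measureReal_iff]
      simpa using (h.measureReal_posPath 0 fun _ => Y 0 ω₀).symm
    · exact ((h.measurable_chain 0 (measurableSet_singleton _)).inter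
        (h.measurable_holding 0 measurableSet_Ioi)).nullMeasurableSet
  filter_upwards [hle.symm.le] with ω hω hω₀ using (hω hω₀).2

theorem ae_holding_succ_pos (h : JumpHoldingLaw b d P Y S) (hb : ∀ i, 0 < b i)
    (hd : ∀ i, 0 ≤ d i) (hd₀ : d 0 = 0) {k : ℕ} (hpos : ∀ᵐ ω ∂P, ∀ r ≤ k, 0 < S r ω) :
    ∀ᵐ ω ∂P, 0 < S (k + 1) ω := by
  refine ae_of_forall_fiber (H := chainPath Y k) fun ω₀ => ?_
  set E : Set Ω := {ω | ∀ r ≤ k, Y r ω = Y r ω₀ ∧ 0 < S r ω}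
  have hEm : MeasurableSet E := by
    have := h.measurable_chain
    have := h.measurable_holding
    measurability
  have hSm : MeasurableSet {ω | 0 < S (k + 1) ω} := h.measurable_holding (k + 1) measurableSet_Ioi
  have hstep : ∀ j, P (E ∩ {ω | 0 < S (k + 1) ω} ∩ Y (k + 1) ⁻¹' {j}) =
      P E * ENNReal.ofReal (jumpProb b d (Y k ω₀) j) := by
    intro j
    have hset : E ∩ {ω | 0 < S (k + 1) ω} ∩ Y (k + 1) ⁻¹' {j} =
        E ∩ {ω | Y (k + 1) ω = j ∧ 0 < S (k + 1) ω} := by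
      ext ω
      simp [and_assoc, and_comm]
    rw [hset, ← ofReal_measureReal, h.measureReal_posPath_inter_succ k (fun r => Y r ω₀) j,
      ENNReal.ofReal_mul measureReal_nonneg, ofReal_measureReal]
  have hmeasure : P (E ∩ {ω | 0 < S (k + 1) ω}) = P E := by
    rw [← tsum_measure_inter_preimage_singleton (h.measurable_chain (k + 1)), tsum_congr hstep,
      ENNReal.tsum_mul_left, tsum_jumpProb hb hd hd₀, mul_one]
  have hle := ae_eq_of_subset_of_measure_ge Set.inter_subset_left hmeasure.ge
    (hEm.inter hSm).nullMeasurableSet (measure_ne_top P E)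
  filter_upwards [hle.symm.le, hpos] with ω hω hpos_ω hpath
  have hYω : ω ∈ {ω | ∀ r ≤ k, Y r ω = Y r ω₀} :=
    preimage_chainPath_singleton k ω₀ ▸ hpath
  exact (hω fun r hr => ⟨hYω r hr, hpos_ω r hr⟩).2

theorem ae_holding_pos (h : JumpHoldingLaw b d P Y S) (hb : ∀ i, 0 < b i) (hd : ∀ i, 0 ≤ d i)
    (hd₀ : d 0 = 0) : ∀ᵐ ω ∂P, ∀ r, 0 < S r ω := by
  have hle : ∀ k, ∀ᵐ ω ∂P, ∀ r ≤ k, 0 < S r ω := by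
    intro k
    induction k with
    | zero => simpa using h.ae_holding_zero_pos
    | succ k ih =>
      filter_upwards [ih, h.ae_holding_succ_pos hb hd hd₀ ih] with ω hω hω' r hr
      rcases Nat.le_add_one_iff.1 hr with hr | rfl
      exacts [hω r hr, hω']
  filter_upwards [ae_all_iff.2 hle] with ω hω r using hω r r le_rfl

theorem posPath_ae_eq_path (h : JumpHoldingLaw b d P Y S) (hb : ∀ i, 0 < b i)
    (hd : ∀ i, 0 ≤ d i) (hd₀ : d 0 = 0) (k : ℕ) (i : ℕ → ℕ) :
    {ω | ∀ r ≤ k, Y r ω = i r ∧ 0 < S r ω} =ᵐ[P] {ω | ∀ r ≤ k, Y r ω = i r} := by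
  filter_upwards [h.ae_holding_pos hb hd hd₀] with ω hω
  refine propext (forall₂_congr fun r _ => ?_)
  simp [hω r]

theorem measureReal_path_inter_lt_holding (h : JumpHoldingLaw b d P Y S) (hb : ∀ i, 0 < b i)
    (hd : ∀ i, 0 ≤ d i) (hd₀ : d 0 = 0) (k : ℕ) (i : ℕ → ℕ) {s : ℝ} (hs : 0 ≤ s) :
    P.real ({ω | ∀ r ≤ k, Y r ω = i r} ∩ {ω | s < S k ω}) =
      P.real {ω | ∀ r ≤ k, Y r ω = i r} * Real.exp (-((b (i k) + d (i k)) * s)) := by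
  have hset : ({ω | ∀ r ≤ k, Y r ω = i r} ∩ {ω | s < S k ω} : Set Ω) =ᵐ[P]
      {ω | ∀ r ≤ k, Y r ω = i r ∧ (Pi.single k s : ℕ → ℝ) r < S r ω} := by
    filter_upwards [h.ae_holding_pos hb hd hd₀] with ω hω
    refine propext ⟨fun hωs r hr => ⟨hωs.1 r hr, ?_⟩, fun hωs => ⟨fun r hr => (hωs r hr).1, ?_⟩⟩
    · rcases eq_or_ne r k with rfl | hrk
      · simpa using hωs.2
      · simpa [hrk] using hω r
    · simpa using (hωs k le_rfl).2
  have hexp : ∏ r ∈ Finset.range k,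
      Real.exp (-((b (i r) + d (i r)) * (Pi.single k s : ℕ → ℝ) r)) = 1 :=
    Finset.prod_eq_one fun r hr => by simp [(Finset.mem_range.1 hr).ne]
  have hsingle : (0 : ℕ → ℝ) ≤ Pi.single k s := Pi.single_nonneg.2 hs
  rw [measureReal_congr hset, h.measureReal_path_holding k i _ hsingle,
    ← measureReal_congr (h.posPath_ae_eq_path hb hd hd₀ k i), h.measureReal_posPath,
    Finset.prod_range_succ, hexp, one_mul, Pi.single_eq_same]

theorem measure_path_inter_chain_succ (h : JumpHoldingLaw b d P Y S) (hb : ∀ i, 0 < b i)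
    (hd : ∀ i, 0 ≤ d i) (hd₀ : d 0 = 0) (k : ℕ) (i : ℕ → ℕ) (j : ℕ) :
    P ({ω | ∀ r ≤ k, Y r ω = i r} ∩ {ω | Y (k + 1) ω = j}) =
      P {ω | ∀ r ≤ k, Y r ω = i r} * ENNReal.ofReal (jumpProb b d (i k) j) := by
  have hsucc : {ω | Y (k + 1) ω = j ∧ 0 < S (k + 1) ω} =ᵐ[P] {ω | Y (k + 1) ω = j} := by
    filter_upwards [h.ae_holding_pos hb hd hd₀] with ω hω
    exact propext (and_iff_left (hω (k + 1)))
  have hpath := h.posPath_ae_eq_path hb hd hd₀ k i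
  rw [← ofReal_measureReal, ← measureReal_congr (hpath.inter hsucc),
    h.measureReal_posPath_inter_succ, measureReal_congr hpath,
    ENNReal.ofReal_mul measureReal_nonneg, ofReal_measureReal]

theorem setLIntegral_holding (h : JumpHoldingLaw b d P Y S) (hb : ∀ i, 0 < b i)
    (hd : ∀ i, 0 ≤ d i) (hd₀ : d 0 = 0) (k : ℕ) (C : Set (Set.Iic k → ℕ)) :
    ∫⁻ ω in chainPath Y k ⁻¹' C, ENNReal.ofReal (S k ω) ∂P =
      ∫⁻ ω in chainPath Y k ⁻¹' C, ENNReal.ofReal (1 / (b (Y k ω) + d (Y k ω))) ∂P := by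
  refine setLIntegral_preimage_congr_of_fiber (h.measurable_chainPath k) (fun ω₀ => ?_) C
  rw [preimage_chainPath_singleton]
  have hE := h.measurableSet_path k fun r => Y r ω₀
  set E : Set Ω := {ω | ∀ r ≤ k, Y r ω = Y r ω₀}
  have hrate : 0 < b (Y k ω₀) + d (Y k ω₀) := add_pos_of_pos_of_nonneg (hb _) (hd _)
  have htail : ∀ s, 0 ≤ s → (P.restrict E).real {ω | s < S k ω} =
      P.real E * Real.exp (-((b (Y k ω₀) + d (Y k ω₀)) * s)) := by
    intro s hs
    rw [measureReal_restrict_apply (measurableSet_lt measurable_const (h.measurable_holding k)),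
      Set.inter_comm]
    exact h.measureReal_path_inter_lt_holding hb hd hd₀ k (fun r => Y r ω₀) hs
  have hS_nonneg : 0 ≤ᵐ[P.restrict E] S k :=
    ae_restrict_of_ae ((h.ae_holding_pos hb hd hd₀).mono fun ω hω => (hω k).le)
  calc ∫⁻ ω in E, ENNReal.ofReal (S k ω) ∂P
      = ENNReal.ofReal (P.real E * (1 / (b (Y k ω₀) + d (Y k ω₀)))) :=
        lintegral_ofReal_of_exp_tail (h.measurable_holding k).aemeasurable hS_nonneg hrate htail
    _ = ∫⁻ _ω in E, ENNReal.ofReal (1 / (b (Y k ω₀) + d (Y k ω₀))) ∂P := by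
        rw [setLIntegral_const, mul_comm, ENNReal.ofReal_mul (by positivity), ofReal_measureReal]
    _ = ∫⁻ ω in E, ENNReal.ofReal (1 / (b (Y k ω) + d (Y k ω))) ∂P :=
        setLIntegral_congr_fun hE fun ω hω => by rw [hω k le_rfl]

theorem setLIntegral_comp_chain_succ (h : JumpHoldingLaw b d P Y S) (hb : ∀ i, 0 < b i)
    (hd : ∀ i, 0 ≤ d i) (hd₀ : d 0 = 0) (g : ℕ → ℝ≥0∞) (k : ℕ) (C : Set (Set.Iic k → ℕ)) :
    ∫⁻ ω in chainPath Y k ⁻¹' C, g (Y (k + 1) ω) ∂P =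
      ∫⁻ ω in chainPath Y k ⁻¹' C, ∑' j, ENNReal.ofReal (jumpProb b d (Y k ω) j) * g j ∂P := by
  refine setLIntegral_preimage_congr_of_fiber (h.measurable_chainPath k) (fun ω₀ => ?_) C
  rw [preimage_chainPath_singleton]
  have hE := h.measurableSet_path k fun r => Y r ω₀
  set E : Set Ω := {ω | ∀ r ≤ k, Y r ω = Y r ω₀}
  have hstep : ∀ j, (P.restrict E).map (Y (k + 1)) {j} =
      P E * ENNReal.ofReal (jumpProb b d (Y k ω₀) j) := by
    intro j
    rw [Measure.map_apply (h.measurable_chain _) (measurableSet_singleton _),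
      Measure.restrict_apply (h.measurable_chain _ (measurableSet_singleton _)), Set.inter_comm]
    exact h.measure_path_inter_chain_succ hb hd hd₀ k (fun r => Y r ω₀) j
  calc ∫⁻ ω in E, g (Y (k + 1) ω) ∂P
      = ∑' j, g j * (P E * ENNReal.ofReal (jumpProb b d (Y k ω₀) j)) := by
        rw [← lintegral_map (.of_discrete) (h.measurable_chain _), lintegral_countable']
        simp_rw [hstep]
    _ = ∫⁻ _ω in E, ∑' j, ENNReal.ofReal (jumpProb b d (Y k ω₀) j) * g j ∂P := by
        rw [setLIntegral_const, ← ENNReal.tsum_mul_right]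
        exact tsum_congr fun j => by ring
    _ = ∫⁻ ω in E, ∑' j, ENNReal.ofReal (jumpProb b d (Y k ω) j) * g j ∂P :=
        setLIntegral_congr_fun hE fun ω hω => by rw [hω k le_rfl]

theorem ae_chain_succ_eq_or (h : JumpHoldingLaw b d P Y S) (hb : ∀ i, 0 < b i)
    (hd : ∀ i, 0 ≤ d i) (hd₀ : d 0 = 0) :
    ∀ᵐ ω ∂P, ∀ k, Y (k + 1) ω = Y k ω + 1 ∨ Y (k + 1) ω + 1 = Y k ω := by
  refine ae_all_iff.2 fun k => ae_of_forall_fiber (H := chainPath Y (k + 1)) fun ω₀ => ?_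
  by_cases hjump : jumpProb b d (Y k ω₀) (Y (k + 1) ω₀) = 0
  · have hnull : P (chainPath Y (k + 1) ⁻¹' {chainPath Y (k + 1) ω₀}) = 0 := by
      refine measure_mono_null (fun ω hω => ?_) <|
        (h.measure_path_inter_chain_succ hb hd hd₀ k (fun r => Y r ω₀) (Y (k + 1) ω₀)).trans
          (by rw [hjump, ENNReal.ofReal_zero, mul_zero])
      rw [preimage_chainPath_singleton] at hω
      exact ⟨fun r hr => hω r (hr.trans k.le_succ), hω (k + 1) le_rfl⟩
    filter_upwards [measure_eq_zero_iff_ae_notMem.1 hnull] with ω hω hpath using absurd hpath hω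
  · refine Filter.Eventually.of_forall fun ω hω => ?_
    have hpath : ∀ r ≤ k + 1, Y r ω = Y r ω₀ := by
      simpa only [chainPath, funext_iff, Subtype.forall, Set.mem_Iic] using hω
    rw [hpath k k.le_succ, hpath (k + 1) le_rfl]
    exact eq_add_one_or_of_jumpProb_ne_zero hjump

theorem setLIntegral_stayBelow_succ (h : JumpHoldingLaw b d P Y S) (hb : ∀ i, 0 < b i)
    (hd : ∀ i, 0 ≤ d i) (hd₀ : d 0 = 0) (K k : ℕ) :
    ∫⁻ ω in stayBelow Y K (k + 1), ENNReal.ofReal (meanPassageTime b d K (Y (k + 1) ω)) ∂P +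
        ∫⁻ ω in stayBelow Y K k, ENNReal.ofReal (S k ω) ∂P =
      ∫⁻ ω in stayBelow Y K k, ENNReal.ofReal (meanPassageTime b d K (Y k ω)) ∂P := by
  have hmeas : Measurable fun ω => ENNReal.ofReal (1 / (b (Y k ω) + d (Y k ω))) :=
    (Measurable.of_discrete (f := fun i => ENNReal.ofReal (1 / (b i + d i)))).comp
      (h.measurable_chain k)
  rw [stayBelow_succ, setLIntegral_lt_inter_meanPassageTime (h.measurable_chain _),
    stayBelow_eq_preimage,
    h.setLIntegral_comp_chain_succ hb hd hd₀ fun j => ENNReal.ofReal (meanPassageTime b d K j),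
    h.setLIntegral_holding hb hd hd₀, ← lintegral_add_right _ hmeas, ← stayBelow_eq_preimage]
  exact setLIntegral_congr_fun (h.measurableSet_stayBelow K k) fun ω hω =>
    tsum_jumpProb_mul_meanPassageTime hb hd hd₀ (hω k le_rfl)

theorem sum_setLIntegral_holding_add (h : JumpHoldingLaw b d P Y S) (hb : ∀ i, 0 < b i)
    (hd : ∀ i, 0 ≤ d i) (hd₀ : d 0 = 0) (K n : ℕ) :
    ∑ k ∈ Finset.range n, ∫⁻ ω in stayBelow Y K k, ENNReal.ofReal (S k ω) ∂P +
        ∫⁻ ω in stayBelow Y K n, ENNReal.ofReal (meanPassageTime b d K (Y n ω)) ∂P =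
      ∫⁻ ω in stayBelow Y K 0, ENNReal.ofReal (meanPassageTime b d K (Y 0 ω)) ∂P := by
  induction n with
  | zero => simp
  | succ n ih =>
    rw [Finset.sum_range_succ, add_assoc, add_comm (∫⁻ ω in stayBelow Y K n, _ ∂P),
      h.setLIntegral_stayBelow_succ hb hd hd₀, ih]

theorem tsum_setLIntegral_holding_ne_top (h : JumpHoldingLaw b d P Y S) (hb : ∀ i, 0 < b i)
    (hd : ∀ i, 0 ≤ d i) (hd₀ : d 0 = 0) (K : ℕ) :
    ∑' k, ∫⁻ ω in stayBelow Y K k, ENNReal.ofReal (S k ω) ∂P ≠ ∞ := by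
  refine ne_top_of_le_ne_top ?_ (ENNReal.tsum_le_of_sum_range_le fun n =>
    le_self_add.trans (h.sum_setLIntegral_holding_add hb hd hd₀ K n).le)
  have hbound : ∀ ω, ENNReal.ofReal (meanPassageTime b d K (Y 0 ω)) ≤
      ENNReal.ofReal (meanPassageTime b d K 0) := fun ω =>
    ENNReal.ofReal_le_ofReal (meanPassageTime_antitone hb hd K (Nat.zero_le _))
  refine ne_top_of_le_ne_top ?_ (lintegral_mono hbound)
  rw [lintegral_const]
  exact ENNReal.mul_ne_top ENNReal.ofReal_ne_top (measure_ne_top _ _)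

theorem setLIntegral_comp_chain_le (h : JumpHoldingLaw b d P Y S) (hb : ∀ i, 0 < b i)
    (hd : ∀ i, 0 ≤ d i) (hd₀ : d 0 = 0) (g : ℕ → ℝ≥0∞) (K k : ℕ) :
    ∫⁻ ω in stayBelow Y K k, g (Y k ω) ∂P ≤
      (∑ i ∈ Finset.range K, g i * ENNReal.ofReal (b i + d i)) *
        ∫⁻ ω in stayBelow Y K k, ENNReal.ofReal (S k ω) ∂P := by
  have hmul : ∀ i, ENNReal.ofReal (b i + d i) * ENNReal.ofReal (1 / (b i + d i)) = 1 := by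
    intro i
    have hrate : 0 < b i + d i := add_pos_of_pos_of_nonneg (hb i) (hd i)
    rw [← ENNReal.ofReal_mul hrate.le, mul_one_div_cancel hrate.ne', ENNReal.ofReal_one]
  have hmeas : Measurable fun ω => ENNReal.ofReal (1 / (b (Y k ω) + d (Y k ω))) :=
    (Measurable.of_discrete (f := fun i => ENNReal.ofReal (1 / (b i + d i)))).comp
      (h.measurable_chain k)
  rw [stayBelow_eq_preimage, h.setLIntegral_holding hb hd hd₀, ← lintegral_const_mul _ hmeas,
    ← stayBelow_eq_preimage]
  refine setLIntegral_mono' (h.measurableSet_stayBelow K k) fun ω hω => ?_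
  calc g (Y k ω)
      = g (Y k ω) * ENNReal.ofReal (b (Y k ω) + d (Y k ω)) *
          ENNReal.ofReal (1 / (b (Y k ω) + d (Y k ω))) := by rw [mul_assoc, hmul, mul_one]
    _ ≤ _ := by
        gcongr
        exact Finset.single_le_sum (f := fun i => g i * ENNReal.ofReal (b i + d i))
          (fun _ _ => zero_le) (Finset.mem_range.2 (hω k le_rfl))

theorem tendsto_setLIntegral_comp_chain (h : JumpHoldingLaw b d P Y S) (hb : ∀ i, 0 < b i)
    (hd : ∀ i, 0 ≤ d i) (hd₀ : d 0 = 0) {g : ℕ → ℝ≥0∞} (hg : ∀ i, g i ≠ ∞) (K : ℕ) :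
    Filter.Tendsto (fun k => ∫⁻ ω in stayBelow Y K k, g (Y k ω) ∂P) Filter.atTop (nhds 0) := by
  have hC : ∑ i ∈ Finset.range K, g i * ENNReal.ofReal (b i + d i) ≠ ∞ :=
    ENNReal.sum_ne_top.2 fun i _ => ENNReal.mul_ne_top (hg i) ENNReal.ofReal_ne_top
  have hholding := ENNReal.Tendsto.const_mul (ENNReal.tendsto_atTop_zero_of_tsum_ne_top
    (h.tsum_setLIntegral_holding_ne_top hb hd hd₀ K)) (.inr hC)
  rw [mul_zero] at hholding
  exact tendsto_of_tendsto_of_tendsto_of_le_of_le tendsto_const_nhds hholding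
    (fun _ => zero_le) fun k => h.setLIntegral_comp_chain_le hb hd hd₀ g K k

theorem ae_exists_le (h : JumpHoldingLaw b d P Y S) (hb : ∀ i, 0 < b i) (hd : ∀ i, 0 ≤ d i)
    (hd₀ : d 0 = 0) (K : ℕ) : ∀ᵐ ω ∂P, ∃ k, K ≤ Y k ω := by
  have hlim : Filter.Tendsto (fun k => P (stayBelow Y K k)) Filter.atTop (nhds 0) := by
    simpa using h.tendsto_setLIntegral_comp_chain hb hd hd₀ (g := 1) (by simp) K
  refine le_antisymm (ge_of_tendsto' hlim fun k => measure_mono fun ω hω r _ => ?_) zero_le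
  simpa using not_exists.1 hω r

theorem lintegral_timeBelow (h : JumpHoldingLaw b d P Y S) (hb : ∀ i, 0 < b i)
    (hd : ∀ i, 0 ≤ d i) (hd₀ : d 0 = 0) (K : ℕ) :
    ∫⁻ ω, timeBelow Y S K ω ∂P = ∫⁻ ω, ENNReal.ofReal (meanPassageTime b d K (Y 0 ω)) ∂P := by
  have hsum := (ENNReal.tendsto_nat_tsum fun k =>
      ∫⁻ ω in stayBelow Y K k, ENNReal.ofReal (S k ω) ∂P).add
    (h.tendsto_setLIntegral_comp_chain hb hd hd₀
      (g := fun i => ENNReal.ofReal (meanPassageTime b d K i)) (fun _ => ENNReal.ofReal_ne_top) K)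
  simp only [h.sum_setLIntegral_holding_add hb hd hd₀, add_zero] at hsum
  have hmeas : ∀ k, Measurable
      ((stayBelow Y K k).indicator fun ω => ENNReal.ofReal (S k ω)) := fun k =>
    (h.measurable_holding k).ennreal_ofReal.indicator (h.measurableSet_stayBelow K k)
  calc ∫⁻ ω, timeBelow Y S K ω ∂P
      = ∑' k, ∫⁻ ω in stayBelow Y K k, ENNReal.ofReal (S k ω) ∂P := by
        simp_rw [timeBelow, lintegral_tsum fun k => (hmeas k).aemeasurable,
          lintegral_indicator (h.measurableSet_stayBelow K _)]
    _ = ∫⁻ ω in stayBelow Y K 0, ENNReal.ofReal (meanPassageTime b d K (Y 0 ω)) ∂P :=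
        tendsto_nhds_unique hsum tendsto_const_nhds
    _ = ∫⁻ ω, ENNReal.ofReal (meanPassageTime b d K (Y 0 ω)) ∂P := h.setLIntegral_stayBelow_zero K

end JumpHoldingLaw

/-- The path `x` visits successively the states `y 0, y 1, …` and stays there for the times
`s 0, s 1, …`. -/
def IsJumpPath (x : ℝ≥0 → ℕ) (y : ℕ → ℕ) (s : ℕ → ℝ) : Prop :=
  ∀ (k : ℕ) (t : ℝ≥0), ∑ r ∈ Finset.range k, s r ≤ (t : ℝ) →
    (t : ℝ) < ∑ r ∈ Finset.range (k + 1), s r → x t = y k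

section JumpPath

variable {x : ℝ≥0 → ℕ} {y : ℕ → ℕ} {s : ℕ → ℝ} {K T : ℕ}

theorem exists_first_hit (hy₀ : y 0 ≤ K) (hy : ∀ k, y (k + 1) = y k + 1 ∨ y (k + 1) + 1 = y k)
    (hK : ∃ k, K ≤ y k) : ∃ T, y T = K ∧ ∀ r < T, y r < K := by
  classical
  have hmin : ∀ r < Nat.find hK, y r < K := fun r hr => not_le.1 (Nat.find_min hK hr)
  refine ⟨Nat.find hK, le_antisymm ?_ (Nat.find_spec hK), hmin⟩
  rcases hT : Nat.find hK with _ | T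
  · exact hy₀
  · have := hmin T (by omega)
    have := hy T
    omega

theorem exists_sum_range_le_lt {t : ℝ} (ht : 0 ≤ t) (htT : t < ∑ r ∈ Finset.range T, s r) :
    ∃ k < T, ∑ r ∈ Finset.range k, s r ≤ t ∧ t < ∑ r ∈ Finset.range (k + 1), s r := by
  induction T with
  | zero => exact absurd htT (by simpa using ht)
  | succ T ih =>
    rcases lt_or_ge t (∑ r ∈ Finset.range T, s r) with htT' | htT'
    · obtain ⟨k, hk, hle, hlt⟩ := ih htT'
      exact ⟨k, by omega, hle, hlt⟩
    · exact ⟨T, T.lt_succ_self, htT', htT⟩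

theorem IsJumpPath.apply_zero (h : IsJumpPath x y s) (hs : 0 < s 0) : x 0 = y 0 :=
  h 0 0 (by simp) (by simpa using hs)

theorem IsJumpPath.isLeast (h : IsJumpPath x y s) (hs : ∀ k, 0 < s k) (hT : y T = K)
    (hmin : ∀ r < T, y r ≠ K) :
    IsLeast {t | x t = K} (∑ r ∈ Finset.range T, s r).toNNReal := by
  have hcoe : ((∑ r ∈ Finset.range T, s r).toNNReal : ℝ) = ∑ r ∈ Finset.range T, s r :=
    Real.coe_toNNReal _ (Finset.sum_nonneg fun r _ => (hs r).le)
  constructor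
  · refine (h T _ hcoe.ge ?_).trans hT
    rw [hcoe, Finset.sum_range_succ]
    exact lt_add_of_pos_right _ (hs T)
  · intro t ht
    by_contra! hlt
    obtain ⟨k, hkT, hle, hlt⟩ := exists_sum_range_le_lt t.2 (Real.lt_toNNReal_iff_coe_lt.1 hlt)
    exact hmin k hkT ((h k t hle hlt).symm.trans ht)

theorem timeBelow_eq_ofReal_sum {Ω : Type*} {Y : ℕ → Ω → ℕ} {S : ℕ → Ω → ℝ} {ω : Ω}
    (hS : ∀ k, 0 ≤ S k ω) (hT : K ≤ Y T ω) (hmin : ∀ r < T, Y r ω < K) :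
    timeBelow Y S K ω = ENNReal.ofReal (∑ r ∈ Finset.range T, S r ω) := by
  rw [timeBelow, ENNReal.ofReal_sum_of_nonneg fun r _ => hS r, tsum_eq_sum (s := Finset.range T)]
  · refine Finset.sum_congr rfl fun k hk => Set.indicator_of_mem ?_ _
    exact fun r hr => hmin r (hr.trans_lt (Finset.mem_range.1 hk))
  · refine fun k hk => Set.indicator_of_notMem (fun hbelow => ?_) _
    exact (hbelow T (not_lt.1 (Finset.mem_range.not.1 hk))).not_ge hT

theorem firstPassageTime_eq_of_isLeast {Ω : Type*} {N : ℝ≥0 → Ω → ℕ} {ω : Ω} {t : ℝ≥0}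
    (ht : IsLeast {t | N t ω = K} t) : firstPassageTime N K ω = t :=
  (ENNReal.coe_mono.map_isLeast ht).csInf_eq

end JumpPath

theorem JumpHoldingLaw.cond {Ω : Type*} [MeasurableSpace Ω] {b d : ℕ → ℝ} {P : Measure Ω}
    {Y : ℕ → Ω → ℕ} {S : ℕ → Ω → ℝ} (h : JumpHoldingLaw b d P Y S) (B : Set ℕ) :
    JumpHoldingLaw b d (P[|Y 0 ⁻¹' B]) Y S := by
  refine ⟨h.measurable_chain, h.measurable_holding, fun k i s hs => ?_⟩
  have hB : MeasurableSet (Y 0 ⁻¹' B) := h.measurable_chain 0 .of_discrete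
  have hpath : {ω | ∀ r ≤ k, Y r ω = i r ∧ s r < S r ω} ⊆ {ω | Y 0 ω = i 0} :=
    fun ω hω => (hω 0 k.zero_le).1
  have hreal : ∀ E, (P[|Y 0 ⁻¹' B]).real E =
      ((P (Y 0 ⁻¹' B))⁻¹).toReal * P.real (Y 0 ⁻¹' B ∩ E) := by
    intro E
    rw [measureReal_def, cond_apply hB, ENNReal.toReal_mul, measureReal_def]
  rw [hreal, hreal]
  by_cases hi : i 0 ∈ B
  · have hstart : {ω | Y 0 ω = i 0} ⊆ Y 0 ⁻¹' B := fun ω (hω : Y 0 ω = i 0) => by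
      rwa [Set.mem_preimage, hω]
    rw [Set.inter_eq_right.2 hstart, Set.inter_eq_right.2 (hpath.trans hstart),
      h.measureReal_path_holding k i s hs]
    ring
  · have hstart : Disjoint (Y 0 ⁻¹' B) {ω | Y 0 ω = i 0} :=
      Set.disjoint_left.2 fun ω hω (hωi : Y 0 ω = i 0) => hi (hωi ▸ hω)
    rw [hstart.inter_eq, (hstart.mono_right hpath).inter_eq]
    simp

namespace IsBirthDeathProcess

variable {Ω : Type*} [MeasurableSpace Ω] {b d : ℕ → ℝ} {P : Measure Ω} {N : ℝ≥0 → Ω → ℕ}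

theorem exists_jumpHoldingLaw (h : IsBirthDeathProcess b d P N) :
    ∃ Y S, JumpHoldingLaw b d P Y S ∧ ∀ᵐ ω ∂P, IsJumpPath (N · ω) (Y · ω) (S · ω) := by
  obtain ⟨Y, S, hY, hS, hlaw, hpath⟩ := h.exists_jump_holding
  exact ⟨Y, S, ⟨hY, hS, hlaw⟩, hpath⟩

section FiniteMeasure

variable [IsFiniteMeasure P]

theorem cond (h : IsBirthDeathProcess b d P N) (B : Set ℕ) :
    IsBirthDeathProcess b d (P[|N 0 ⁻¹' B]) N := by
  obtain ⟨Y, S, hlaw, hpath⟩ := h.exists_jumpHoldingLaw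
  have hstart : N 0 ⁻¹' B =ᵐ[P] Y 0 ⁻¹' B := by
    filter_upwards [hpath, hlaw.ae_holding_zero_pos] with ω hω hpos
    exact congrArg (· ∈ B) (hω.apply_zero hpos)
  have hcond : P[|N 0 ⁻¹' B] = P[|Y 0 ⁻¹' B] := by
    rw [ProbabilityTheory.cond, ProbabilityTheory.cond, measure_congr hstart,
      Measure.restrict_congr_set hstart]
  have hlaw' := hlaw.cond B
  exact ⟨h.measurable, Y, S, hlaw'.measurable_chain, hlaw'.measurable_holding,
    hcond ▸ hlaw'.measureReal_path_holding, cond_absolutelyContinuous.ae_le hpath⟩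

variable {K : ℕ}

theorem exists_measurable_isLeast (h : IsBirthDeathProcess b d P N) (hb : ∀ i, 0 < b i)
    (hd : ∀ i, 0 ≤ d i) (hd₀ : d 0 = 0) (hN₀ : ∀ᵐ ω ∂P, N 0 ω ≤ K) :
    ∃ g : Ω → ℝ≥0∞, Measurable g ∧
      (∀ᵐ ω ∂P, ∃ t : ℝ≥0, IsLeast {t | N t ω = K} t ∧ (t : ℝ≥0∞) = g ω) ∧
      ∫⁻ ω, g ω ∂P = ∫⁻ ω, ENNReal.ofReal (meanPassageTime b d K (N 0 ω)) ∂P := by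
  obtain ⟨Y, S, hlaw, hpath⟩ := h.exists_jumpHoldingLaw
  have hpos := hlaw.ae_holding_pos hb hd hd₀
  have hstart : ∀ᵐ ω ∂P, N 0 ω = Y 0 ω := by
    filter_upwards [hpath, hpos] with ω hω hpos_ω using hω.apply_zero (hpos_ω 0)
  refine ⟨timeBelow Y S K, hlaw.measurable_timeBelow K, ?_, ?_⟩
  · filter_upwards [hpath, hpos, hstart, hN₀, hlaw.ae_chain_succ_eq_or hb hd hd₀,
      hlaw.ae_exists_le hb hd hd₀ K] with ω hω hpos_ω hstart_ω hN₀_ω hstep hK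
    obtain ⟨T, hT, hmin⟩ := exists_first_hit (hstart_ω ▸ hN₀_ω) hstep hK
    exact ⟨_, hω.isLeast hpos_ω hT fun r hr => (hmin r hr).ne,
      (timeBelow_eq_ofReal_sum (fun k => (hpos_ω k).le) hT.ge hmin).symm⟩
  · rw [hlaw.lintegral_timeBelow hb hd hd₀]
    exact lintegral_congr_ae (hstart.mono fun ω hω => by simp only [hω])

theorem ae_exists_isLeast (h : IsBirthDeathProcess b d P N) (hb : ∀ i, 0 < b i)
    (hd : ∀ i, 0 ≤ d i) (hd₀ : d 0 = 0) (hN₀ : ∀ᵐ ω ∂P, N 0 ω ≤ K) :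
    ∀ᵐ ω ∂P, ∃ t, IsLeast {t : ℝ≥0 | N t ω = K} t := by
  obtain ⟨g, -, hg, -⟩ := h.exists_measurable_isLeast hb hd hd₀ hN₀
  exact hg.mono fun ω ⟨t, ht, _⟩ => ⟨t, ht⟩

theorem aemeasurable_firstPassageTime (h : IsBirthDeathProcess b d P N) (hb : ∀ i, 0 < b i)
    (hd : ∀ i, 0 ≤ d i) (hd₀ : d 0 = 0) (hN₀ : ∀ᵐ ω ∂P, N 0 ω ≤ K) :
    AEMeasurable (firstPassageTime N K) P := by
  obtain ⟨g, hgm, hg, -⟩ := h.exists_measurable_isLeast hb hd hd₀ hN₀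
  exact ⟨g, hgm, hg.mono fun ω ⟨t, ht, htg⟩ => (firstPassageTime_eq_of_isLeast ht).trans htg⟩

theorem lintegral_firstPassageTime (h : IsBirthDeathProcess b d P N) (hb : ∀ i, 0 < b i)
    (hd : ∀ i, 0 ≤ d i) (hd₀ : d 0 = 0) (hN₀ : ∀ᵐ ω ∂P, N 0 ω ≤ K) :
    ∫⁻ ω, firstPassageTime N K ω ∂P =
      ∫⁻ ω, ENNReal.ofReal (meanPassageTime b d K (N 0 ω)) ∂P := by
  obtain ⟨g, -, hg, hmean⟩ := h.exists_measurable_isLeast hb hd hd₀ hN₀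
  rw [← hmean]
  exact lintegral_congr_ae <|
    hg.mono fun ω ⟨t, ht, htg⟩ => (firstPassageTime_eq_of_isLeast ht).trans htg

end FiniteMeasure

variable [IsProbabilityMeasure P] {K : ℕ}

theorem lintegral_firstPassageTime_of_ae_eq (h : IsBirthDeathProcess b d P N)
    (hb : ∀ i, 0 < b i) (hd : ∀ i, 0 ≤ d i) (hd₀ : d 0 = 0)
    {n : ℕ} (hN₀ : ∀ᵐ ω ∂P, N 0 ω = n) (hn : n ≤ K) :
    ∫⁻ ω, firstPassageTime N K ω ∂P = ENNReal.ofReal (meanPassageTime b d K n) := by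
  calc ∫⁻ ω, firstPassageTime N K ω ∂P
      = ∫⁻ ω, ENNReal.ofReal (meanPassageTime b d K (N 0 ω)) ∂P :=
        h.lintegral_firstPassageTime hb hd hd₀ (hN₀.mono fun ω hω => hω.trans_le hn)
    _ = ∫⁻ _, ENNReal.ofReal (meanPassageTime b d K n) ∂P :=
        lintegral_congr_ae (hN₀.mono fun ω hω => by simp only [hω])
    _ = ENNReal.ofReal (meanPassageTime b d K n) := by rw [lintegral_const, measure_univ, mul_one]

theorem hasDerivWithinAt_laplace_firstPassageTime (h : IsBirthDeathProcess b d P N)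
    (hb : ∀ i, 0 < b i) (hd : ∀ i, 0 ≤ d i) (hd₀ : d 0 = 0)
    {n : ℕ} (hN₀ : ∀ᵐ ω ∂P, N 0 ω = n) (hn : n ≤ K) :
    HasDerivWithinAt (fun θ : ℝ => ∫ ω, Real.exp (-(θ * (firstPassageTime N K ω).toReal)) ∂P)
      (-meanPassageTime b d K n) (Set.Ici 0) 0 := by
  have hmean := h.lintegral_firstPassageTime_of_ae_eq hb hd hd₀ hN₀ hn
  have hτ := h.aemeasurable_firstPassageTime hb hd hd₀ (hN₀.mono fun ω hω => hω.trans_le hn)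
  have hderiv := hasDerivWithinAt_laplace_toReal_zero hτ (hmean ▸ ENNReal.ofReal_ne_top)
  rwa [hmean, ENNReal.toReal_ofReal (meanPassageTime_nonneg hb hd K n)] at hderiv

end IsBirthDeathProcess

section ErlangA

variable {m : ℕ} {ρ η : ℝ}

theorem erlangADeathRate_zero (m : ℕ) (η : ℝ) : erlangADeathRate m η 0 = 0 := by
  simp [erlangADeathRate]

theorem erlangADeathRate_of_le {n : ℕ} (hn : n ≤ m) : erlangADeathRate m η n = n := if_pos hn

theorem erlangADeathRate_of_ge (hη : η ≠ 0) {n : ℕ} (hn : m ≤ n) :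
    erlangADeathRate m η n = ((n : ℝ) - m + m / η) * η := by
  rcases hn.eq_or_lt with rfl | hn
  · rw [erlangADeathRate_of_le le_rfl, sub_self, zero_add, div_mul_cancel₀ _ hη]
  · rw [erlangADeathRate, if_neg (not_le.2 hn), add_mul, div_mul_cancel₀ _ hη, add_comm]

theorem erlangADeathRate_nonneg (hη : 0 < η) (n : ℕ) : 0 ≤ erlangADeathRate m η n := by
  rcases le_total n m with hn | hn
  · rw [erlangADeathRate_of_le hn]
    positivity
  · have : (0 : ℝ) ≤ n - m := sub_nonneg.2 (Nat.cast_le.2 hn)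
    rw [erlangADeathRate_of_ge hη.ne' hn]
    positivity

theorem prod_erlangADeathRate_div_of_le (hρ : ρ ≠ 0) {l J : ℕ} (hlJ : l ≤ J) (hJm : J ≤ m) :
    ∏ r ∈ Finset.Ioc l J, erlangADeathRate m η r / ρ =
      (J.factorial : ℝ) / l.factorial * ρ ^ ((l : ℤ) - J) := by
  induction J, hlJ using Nat.le_induction with
  | base =>
    have : (l.factorial : ℝ) ≠ 0 := by positivity
    simp [this]
  | succ J hlJ ih =>
    rw [Finset.prod_Ioc_succ_top hlJ, ih (Nat.le_of_succ_le hJm), erlangADeathRate_of_le hJm,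
      Nat.factorial_succ, Nat.cast_mul, Nat.cast_succ (R := ℤ), ← sub_sub, zpow_sub_one₀ hρ]
    ring

theorem prod_erlangADeathRate_div_of_ge (hρ : 0 < ρ) (hη : 0 < η) {l J : ℕ} (hml : m ≤ l)
    (hlJ : l ≤ J) :
    ∏ r ∈ Finset.Ioc l J, erlangADeathRate m η r / ρ =
      (ρ / η) ^ ((l : ℤ) - J) *
        (Real.Gamma ((J : ℝ) - m + 1 + m / η) / Real.Gamma ((l : ℝ) - m + 1 + m / η)) := by
  have hpos : ∀ J : ℕ, m ≤ J → 0 < (J : ℝ) - m + 1 + m / η := by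
    intro J hmJ
    have : (0 : ℝ) ≤ J - m := sub_nonneg.2 (Nat.cast_le.2 hmJ)
    positivity
  induction J, hlJ using Nat.le_induction with
  | base =>
    rw [Finset.Ioc_self, Finset.prod_empty, sub_self, zpow_zero, one_mul,
      div_self (Real.Gamma_pos_of_pos (hpos l hml)).ne']
  | succ J hlJ ih =>
    have hmJ := hml.trans hlJ
    have hcast : ((J + 1 : ℕ) : ℝ) - m + m / η = (J : ℝ) - m + 1 + m / η := by
      push_cast
      ring
    have hGamma : Real.Gamma (((J + 1 : ℕ) : ℝ) - m + 1 + m / η) =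
        ((J : ℝ) - m + 1 + m / η) * Real.Gamma ((J : ℝ) - m + 1 + m / η) := by
      rw [← Real.Gamma_add_one (hpos J hmJ).ne', ← hcast]
      congr 1
      ring
    rw [Finset.prod_Ioc_succ_top hlJ, ih, erlangADeathRate_of_ge hη.ne' (hmJ.trans J.le_succ),
      hcast, hGamma, Nat.cast_succ (R := ℤ), ← sub_sub, zpow_sub_one₀ (by positivity), inv_div]
    ring

theorem meanUpTime_erlangA_of_le (hρ : ρ ≠ 0) {j : ℕ} (hj : j ≤ m) :
    meanUpTime (fun _ => ρ) (erlangADeathRate m η) j = (j.factorial : ℝ) * ρ ^ (-(j : ℤ)) *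
      ∑ l ∈ Finset.range (j + 1), ρ ^ ((l : ℤ) - 1) / (l.factorial : ℝ) := by
  rw [meanUpTime_eq_sum, Finset.mul_sum]
  refine Finset.sum_congr rfl fun l hl => ?_
  rw [prod_erlangADeathRate_div_of_le hρ (Finset.mem_range_succ_iff.1 hl) hj, sub_eq_add_neg,
    zpow_add₀ hρ, zpow_sub_one₀ hρ]
  ring

theorem meanUpTime_erlangA_of_ge (hρ : 0 < ρ) (hη : 0 < η) {J : ℕ} (hmJ : m ≤ J) :
    meanUpTime (fun _ => ρ) (erlangADeathRate m η) J = 1 / ρ *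
      ((ρ / η) ^ ((m : ℤ) - (J : ℤ)) *
            (Real.Gamma ((J : ℝ) - m + 1 + m / η) / Real.Gamma (1 + m / η)) *
            (∑ l ∈ Finset.range (m + 1),
              (m.factorial : ℝ) / (l.factorial : ℝ) * ρ ^ ((l : ℤ) - (m : ℤ))) +
          ∑ l ∈ Finset.Icc (m + 1) J,
            (ρ / η) ^ ((l : ℤ) - (J : ℤ)) *
              (Real.Gamma ((J : ℝ) - m + 1 + m / η) /
                Real.Gamma ((l : ℝ) - m + 1 + m / η))) := by
  have hprod_m := prod_erlangADeathRate_div_of_ge hρ hη le_rfl hmJ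
  rw [sub_self, zero_add] at hprod_m
  rw [meanUpTime_eq_sum, ← Finset.mul_sum,
    ← Finset.sum_range_add_sum_Ico _ (Nat.succ_le_succ hmJ), Finset.mul_sum, ← hprod_m]
  congr 2
  · refine Finset.sum_congr rfl fun l hl => ?_
    have hlm := Finset.mem_range_succ_iff.1 hl
    rw [← Finset.prod_Ioc_consecutive _ hlm hmJ, mul_comm,
      prod_erlangADeathRate_div_of_le hρ.ne' hlm le_rfl]
  · refine Finset.sum_congr rfl fun l hl => ?_
    obtain ⟨hml, hlJ⟩ := Finset.mem_Icc.1 hl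
    exact prod_erlangADeathRate_div_of_ge hρ hη (Nat.le_of_succ_le hml) hlJ

theorem meanPassageTime_erlangA_of_ge (hρ : 0 < ρ) (hη : 0 < η) {n : ℕ} (hmn : m ≤ n) (K : ℕ) :
    meanPassageTime (fun _ => ρ) (erlangADeathRate m η) K n =
      1 / ρ * ∑ J ∈ Finset.Ico n K,
        ((ρ / η) ^ ((m : ℤ) - (J : ℤ)) *
            (Real.Gamma ((J : ℝ) - m + 1 + m / η) / Real.Gamma (1 + m / η)) *
            (∑ l ∈ Finset.range (m + 1),
              (m.factorial : ℝ) / (l.factorial : ℝ) * ρ ^ ((l : ℤ) - (m : ℤ))) +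
          ∑ l ∈ Finset.Icc (m + 1) J,
            (ρ / η) ^ ((l : ℤ) - (J : ℤ)) *
              (Real.Gamma ((J : ℝ) - m + 1 + m / η) /
                Real.Gamma ((l : ℝ) - m + 1 + m / η))) := by
  rw [meanPassageTime, Finset.mul_sum]
  exact Finset.sum_congr rfl fun J hJ =>
    meanUpTime_erlangA_of_ge hρ hη (hmn.trans (Finset.mem_Ico.1 hJ).1)

theorem meanPassageTime_erlangA_of_ge_split (hρ : 0 < ρ) (hη : 0 < η) {n : ℕ} (hmn : m ≤ n)
    (K : ℕ) :
    meanPassageTime (fun _ => ρ) (erlangADeathRate m η) K n =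
      1 / ρ * (∑ J ∈ Finset.Ico n K, ∑ l ∈ Finset.Icc (m + 1) J,
          (ρ / η) ^ ((l : ℤ) - (J : ℤ)) *
            (Real.Gamma ((J : ℝ) - m + 1 + m / η) / Real.Gamma ((l : ℝ) - m + 1 + m / η))) +
      1 / ρ * (ρ / η) ^ m * (1 / Real.Gamma (1 + m / η)) *
        (∑ l ∈ Finset.range (m + 1),
          (m.factorial : ℝ) / (l.factorial : ℝ) * ρ ^ ((l : ℤ) - (m : ℤ))) *
        (∑ J ∈ Finset.Ico n K, (η / ρ) ^ J * Real.Gamma ((J : ℝ) - m + 1 + m / η)) := by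
  rw [meanPassageTime_erlangA_of_ge hρ hη hmn, Finset.sum_add_distrib, mul_add, add_comm]
  congr 1
  rw [Finset.mul_sum (Finset.Ico n K), Finset.mul_sum (Finset.Ico n K)]
  refine Finset.sum_congr rfl fun J _ => ?_
  rw [zpow_sub₀ (by positivity), zpow_natCast, zpow_natCast, div_eq_mul_inv ((ρ / η) ^ m),
    ← inv_pow, inv_div]
  ring

end ErlangA

theorem corollary8 (m nstar : ℕ) (hm : 1 ≤ m) (hmn : m < nstar)
    (ρ η : ℝ) (hρ : 0 < ρ) (hη : 0 < η) :
    ∃ q : ℕ → ℝ,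
      -- `q n` is the mean first passage time from `n` to `nstar`, for every Erlang A process
      (∀ (Ω : Type*) [MeasurableSpace Ω] (P : Measure Ω) [IsProbabilityMeasure P]
        (N : ℝ≥0 → Ω → ℕ), IsErlangA m ρ η P N →
        ∀ n ≤ nstar, P {ω | N 0 ω = n} ≠ 0 →
          (∀ᵐ ω ∂(ProbabilityTheory.cond P {ω | N 0 ω = n}),
            ∃ t : ℝ≥0, IsLeast {t : ℝ≥0 | N t ω = nstar} t) ∧
          AEMeasurable (firstPassageTime N nstar)
            (ProbabilityTheory.cond P {ω | N 0 ω = n}) ∧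
          (∫⁻ ω, firstPassageTime N nstar ω ∂(ProbabilityTheory.cond P {ω | N 0 ω = n})) =
            ENNReal.ofReal (q n) ∧
          HasDerivWithinAt
            (fun θ : ℝ => ∫ ω, Real.exp (-(θ * (firstPassageTime N nstar ω).toReal))
              ∂(ProbabilityTheory.cond P {ω | N 0 ω = n}))
            (-(q n)) (Set.Ici 0) 0) ∧
      -- the case `0 ≤ n ≤ m`
      (∀ n ≤ m, q n = q m + ∑ j ∈ Finset.Ico n m,
        (j.factorial : ℝ) * ρ ^ (-(j : ℤ)) *
          ∑ l ∈ Finset.range (j + 1), ρ ^ ((l : ℤ) - 1) / (l.factorial : ℝ)) ∧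
      -- the value at `m`
      (q m = 1 / ρ * ∑ J ∈ Finset.Ico m nstar,
        ((ρ / η) ^ ((m : ℤ) - (J : ℤ)) *
            (Real.Gamma ((J : ℝ) - m + 1 + m / η) / Real.Gamma (1 + m / η)) *
            (∑ l ∈ Finset.range (m + 1),
              (m.factorial : ℝ) / (l.factorial : ℝ) * ρ ^ ((l : ℤ) - (m : ℤ))) +
          ∑ l ∈ Finset.Icc (m + 1) J,
            (ρ / η) ^ ((l : ℤ) - (J : ℤ)) *
              (Real.Gamma ((J : ℝ) - m + 1 + m / η) /
                Real.Gamma ((l : ℝ) - m + 1 + m / η)))) ∧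
      -- the case `m ≤ n < nstar`
      (∀ n, m ≤ n → n < nstar → q n =
        1 / ρ * (∑ J ∈ Finset.Ico n nstar, ∑ l ∈ Finset.Icc (m + 1) J,
            (ρ / η) ^ ((l : ℤ) - (J : ℤ)) *
              (Real.Gamma ((J : ℝ) - m + 1 + m / η) /
                Real.Gamma ((l : ℝ) - m + 1 + m / η))) +
        1 / ρ * (ρ / η) ^ m * (1 / Real.Gamma (1 + m / η)) *
          (∑ l ∈ Finset.range (m + 1),
            (m.factorial : ℝ) / (l.factorial : ℝ) * ρ ^ ((l : ℤ) - (m : ℤ))) *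
          (∑ J ∈ Finset.Ico n nstar,
            (η / ρ) ^ J * Real.Gamma ((J : ℝ) - m + 1 + m / η))) ∧
      q nstar = 0 := by
  refine ⟨meanPassageTime (fun _ => ρ) (erlangADeathRate m η) nstar, ?_, fun n hn => ?_,
    meanPassageTime_erlangA_of_ge hρ hη le_rfl nstar,
    fun n hn _ => meanPassageTime_erlangA_of_ge_split hρ hη hn nstar, meanPassageTime_of_le le_rfl⟩
  · intro Ω _ P _ N hN n hn hPn
    have hcond := IsBirthDeathProcess.cond hN {n}
    have : IsProbabilityMeasure (P[|N 0 ⁻¹' {n}]) := cond_isProbabilityMeasure hPn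
    have hstart : ∀ᵐ ω ∂P[|N 0 ⁻¹' {n}], N 0 ω = n :=
      ae_cond_mem (hN.measurable 0 (measurableSet_singleton n))
    have hle : ∀ᵐ ω ∂P[|N 0 ⁻¹' {n}], N 0 ω ≤ nstar := hstart.mono fun ω hω => hω.trans_le hn
    have hρ' : ∀ _ : ℕ, 0 < ρ := fun _ => hρ
    have hd := erlangADeathRate_nonneg (m := m) hη
    have hd₀ := erlangADeathRate_zero m η
    exact ⟨hcond.ae_exists_isLeast hρ' hd hd₀ hle,
      hcond.aemeasurable_firstPassageTime hρ' hd hd₀ hle,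
      hcond.lintegral_firstPassageTime_of_ae_eq hρ' hd hd₀ hstart hn,
      hcond.hasDerivWithinAt_laplace_firstPassageTime hρ' hd hd₀ hstart hn⟩
  · rw [meanPassageTime_eq_add_sum hn hmn.le]
    exact congrArg _ <| Finset.sum_congr rfl fun j hj =>
      meanUpTime_erlangA_of_le hρ.ne' (Finset.mem_Ico.1 hj).2.le
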